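/- Both least sizes below exist, and $\mathfrak{hc} = \mathfrak{st}$. Here the uncountable Hadwiger conjecture number $\mathfrak{hc}$ is the least cardinality $|V|$ of the vertex set of a (simple, undirected) graph $G=(V,E)$ whose chromatic number is uncountable and which has no $K_{\omega_1}$ minor, and the special tree number $\mathfrak{st}$ is the least cardinality of a non-special tree with no uncountable branch. The chromatic number of $G$ is the least cardinal $\mu$ for which there is $c\colon V\to\mu$ with $c(u)\neq c(v)$ whenever $\{u,v\}\in E$. A graph $G$ has a $K_{\omega_1}$ minor if there are pairwise disjoint non-empty sets $X_\alpha\subseteq V$ ($\alpha<\omega_1$), each inducing a connected subgraph of $G$, such that for all $\alpha\ne\beta$ some edge of $G$ joins a vertex of $X_\alpha$ to a vertex of $X_\beta$. A tree is a partially ordered set $(T,\le)$ in which $\{s\in T : s<t\}$ is well-ordered for every $t\in T$; a branch is a maximal chain of $T$; and $T$ is special if there is a function $f\colon T\to\omega$ that is injective on every chain of $T$. -/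

import Mathlib

open Cardinal Ordinal

universe u v

namespace UncountableHadwiger

/-- The chromatic number of a graph as a cardinal: the least cardinal `μ` such that the graph has a
proper coloring with `μ` colors. (Mathlib's `SimpleGraph.chromaticNumber` is `ℕ∞`-valued and does
not distinguish infinite cardinals.) -/
noncomputable def chromaticCardinal {V : Type u} (G : SimpleGraph V) : Cardinal.{u} :=
  sInf {μ : Cardinal.{u} | ∃ C : Type u, #C = μ ∧ Nonempty (G.Coloring C)}

/-- `G` is a minor of `H`: there are pairwise disjoint non-empty vertex sets `X u` of `H`, indexed by
the vertices of `G`, each inducing a connected subgraph of `H` (`SimpleGraph.Connected` includes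
non-emptiness), such that adjacent vertices of `G` are sent to sets joined by an edge of `H`. -/
def IsMinor {V : Type u} {W : Type v} (G : SimpleGraph V) (H : SimpleGraph W) : Prop :=
  ∃ X : V → Set W,
    (∀ a b : V, a ≠ b → Disjoint (X a) (X b)) ∧
    (∀ a : V, (H.induce (X a)).Connected) ∧
    (∀ a b : V, G.Adj a b → ∃ x ∈ X a, ∃ y ∈ X b, H.Adj x y)

/-- The complete graph `K_{ω₁}`. -/
def completeOmegaOne : SimpleGraph (ω_ 1 : Ordinal.{u}).ToType :=
  SimpleGraph.completeGraph (ω_ 1 : Ordinal.{u}).ToType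

/-- A (set-theoretic) tree: a poset in which the predecessors of each element are well-ordered. -/
def IsSetTree (T : Type u) [PartialOrder T] : Prop :=
  ∀ t : T, IsWellOrder (Set.Iio t) (fun a b => a < b)

/-- A branch is a maximal chain. -/
def IsBranch {T : Type u} [PartialOrder T] (b : Set T) : Prop :=
  IsMaxChain (fun s t : T => s ≤ t) b

/-- A tree is special if there is a function `f : T → ω` which is injective on chains. -/
def IsSpecial (T : Type u) [PartialOrder T] : Prop :=
  ∃ f : T → ℕ, ∀ c : Set T, IsChain (fun s t : T => s ≤ t) c → Set.InjOn f c

/-- The sizes of the uncountably chromatic graphs with no `K_{ω₁}` minor. -/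
def hadwigerSizes : Set Cardinal.{u} :=
  {μ | ∃ (V : Type u) (G : SimpleGraph V),
    #V = μ ∧ ℵ₀ < chromaticCardinal G ∧ ¬ IsMinor completeOmegaOne.{u} G}

/-- The sizes of the non-special trees with no uncountable branch. -/
def specialTreeSizes : Set Cardinal.{u} :=
  {μ | ∃ (T : Type u) (_ : PartialOrder T),
    #T = μ ∧ IsSetTree T ∧ ¬ IsSpecial T ∧ ¬ ∃ b : Set T, IsBranch b ∧ ¬ b.Countable}

/-- The uncountable Hadwiger conjecture number `𝔥𝔠`. -/
noncomputable def hadwigerNumber : Cardinal.{u} := sInf hadwigerSizes.{u}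

/-- The special tree number `𝔰𝔱`. -/
noncomputable def specialTreeNumber : Cardinal.{u} := sInf specialTreeSizes.{u}

end UncountableHadwiger

/-! The two sets of sizes coincide: trees and graphs are converted into each other on the same
underlying set.

From a tree, take the comparability graph. A countable colouring makes the tree special, and in a
`K_{ω₁}` minor each branch set has a least element; these roots are pairwise comparable, so they
form an uncountable chain (`IsSetTree.not_isMinor`).

From a graph, remove layers along `ω₁`. Each layer takes from every remaining component a countable
connected set adjacent to all earlier layers that the component touches (`exists_isLayering`). A
thread, that is, a coherent choice of components at all levels, yields a `K_{ω₁}` minor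
(`IsLayering.isMinor_of_thread`). Without such a minor the layers exhaust the graph and induce a
tree order in which adjacent vertices are comparable, so a specializing map is a countable
colouring; an uncountable chain would again give a thread.

Nonemptiness comes from Kurepa's tree of well-ordered sets of reals under end-extension. -/

namespace UncountableHadwiger

/-! ### Trees and comparability graphs. -/

section Trees

variable {T : Type u} [PartialOrder T]

theorem IsSetTree.le_or_le (hT : IsSetTree T) {s s' t : T} (hs : s ≤ t) (hs' : s' ≤ t) :
    s ≤ s' ∨ s' ≤ s := by
  rcases hs.eq_or_lt with rfl | h
  · exact Or.inr hs'
  rcases hs'.eq_or_lt with rfl | h'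
  · exact Or.inl hs
  by_contra! hc
  have := (hT t).trichotomous ⟨s, h⟩ ⟨s', h'⟩ (fun hlt => hc.1 (le_of_lt (α := T) hlt))
    (fun hlt => hc.2 (le_of_lt (α := T) hlt))
  exact hc.1 (congrArg Subtype.val this).le

theorem isSetTree_of_comparable
    (hcomp : ∀ s s' t : T, s ≤ t → s' ≤ t → s ≤ s' ∨ s' ≤ s)
    (hmin : ∀ t : T, ∀ S : Set T, S.Nonempty → S ⊆ Set.Iio t → ∃ m ∈ S, ∀ s ∈ S, ¬ s < m) :
    IsSetTree T := by
  intro t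
  refine { wf := ?_, trichotomous := ?_ }
  · rw [WellFounded.wellFounded_iff_has_min]
    rintro S ⟨x, hx⟩
    obtain ⟨m, ⟨m', hm', rfl⟩, hm⟩ := hmin t (Subtype.val '' S) ⟨x, x, hx, rfl⟩
      (by rintro _ ⟨y, -, rfl⟩; exact y.2)
    exact ⟨m', hm', fun s hs => hm s ⟨s, hs, rfl⟩⟩
  · rintro ⟨a, ha⟩ ⟨b, hb⟩ hab hba
    have hab : ¬ a < b := hab
    have hba : ¬ b < a := hba
    refine Subtype.ext ?_
    rcases hcomp a b t (le_of_lt ha) (le_of_lt hb) with h | h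
    · exact h.eq_of_not_lt hab
    · exact (h.eq_of_not_lt hba).symm

theorem IsSetTree.exists_min (hT : IsSetTree T) {S : Set T} (hS : S.Nonempty) :
    ∃ m ∈ S, ∀ s ∈ S, s ≤ m → s = m := by
  obtain ⟨t, ht⟩ := hS
  by_cases h : ∃ s ∈ S, s < t
  · obtain ⟨s, hs, hst⟩ := h
    have hwf := (hT t).wf
    obtain ⟨m, hm, hmin⟩ := hwf.has_min {x : Set.Iio t | x.1 ∈ S} ⟨⟨s, hst⟩, hs⟩
    refine ⟨m.1, hm, fun s hs hle => ?_⟩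
    exact hle.eq_of_not_lt fun hlt => hmin ⟨s, hlt.trans m.2⟩ hs hlt
  · push Not at h
    exact ⟨t, ht, fun s hs hle => hle.eq_of_not_lt (h s hs)⟩

theorem IsSetTree.isChain_Iic (hT : IsSetTree T) (t : T) :
    IsChain (fun s t : T => s ≤ t) (Set.Iic t) :=
  fun _ ha _ hb _ => hT.le_or_le ha hb

theorem exists_uncountable_branch_iff :
    (∃ b : Set T, IsBranch b ∧ ¬ b.Countable) ↔
      ∃ c : Set T, IsChain (fun s t : T => s ≤ t) c ∧ ¬ c.Countable := by
  constructor
  · rintro ⟨b, hb, hc⟩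
    exact ⟨b, hb.1, hc⟩
  · rintro ⟨c, hc, hu⟩
    obtain ⟨M, hM, hcM⟩ := hc.exists_maxChain
    exact ⟨M, hM, fun h => hu (h.mono hcM)⟩

variable (T) in
/-- The comparability graph of a partial order. -/
def comparabilityGraph : SimpleGraph T where
  Adj s t := s ≠ t ∧ (s ≤ t ∨ t ≤ s)
  symm := ⟨fun _ _ h => ⟨h.1.symm, h.2.symm⟩⟩
  loopless := ⟨fun _ h => h.1 rfl⟩

theorem IsSetTree.exists_le_of_walk (hT : IsSetTree T) {X : Set T} {x y : X}
    (p : ((comparabilityGraph T).induce X).Walk x y) :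
    ∃ m ∈ X, m ≤ x ∧ m ≤ y := by
  induction p with
  | nil => exact ⟨_, Subtype.property _, le_rfl, le_rfl⟩
  | @cons a b c h p ih =>
    obtain ⟨m, hm, hb, hc⟩ := ih
    rcases h.2 with hab | hba
    · rcases hT.le_or_le (s := a.1) hab hb with h' | h'
      · exact ⟨a, a.2, le_rfl, h'.trans hc⟩
      · exact ⟨m, hm, h', hc⟩
    · exact ⟨m, hm, hb.trans hba, hc⟩

/-- A walk from a minimal element to any other has a common lower bound of its ends inside the set,
by induction on the walk; minimality forces it to be the minimal element. -/
theorem IsSetTree.exists_isLeast_of_connected (hT : IsSetTree T) {X : Set T}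
    (hX : ((comparabilityGraph T).induce X).Connected) : ∃ m, IsLeast X m := by
  obtain ⟨x⟩ := hX.nonempty
  obtain ⟨m, hm, hmin⟩ := hT.exists_min ⟨x.1, x.2⟩
  refine ⟨m, hm, fun y hy => ?_⟩
  obtain ⟨p⟩ := hX.preconnected ⟨m, hm⟩ ⟨y, hy⟩
  obtain ⟨r, hr, hrm, hry⟩ := hT.exists_le_of_walk p
  rwa [← hmin r hr hrm]

end Trees

/-! ### Countability, colourings, and the inclusion from trees to graphs. -/

theorem not_countable_omegaOne : ¬ Countable (ω_ 1 : Ordinal.{u}).ToType := by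
  rw [← Cardinal.mk_le_aleph0_iff, not_le]
  simp

theorem countable_Iio_omegaOne : ∀ a : (ω_ 1 : Ordinal.{u}).ToType, (Set.Iio a).Countable := by
  rw [← ord_aleph]
  intro a
  rw [← Cardinal.le_aleph0_iff_set_countable, ← not_lt, ← Cardinal.aleph_one_le_iff, not_le]
  exact (Cardinal.mk_Iio_lt a (by simp)).trans_eq (by simp)

theorem exists_omegaOne_embedding {A : Type u} (hA : ¬ Countable A) :
    Nonempty ((ω_ 1 : Ordinal.{u}).ToType ↪ A) := by
  rw [← Cardinal.mk_le_aleph0_iff, not_le, ← Cardinal.aleph_one_le_iff] at hA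
  refine (Cardinal.le_def _ _).1 ?_
  simpa using hA

theorem chromaticCardinal_le_aleph0_iff {V : Type u} (G : SimpleGraph V) :
    chromaticCardinal G ≤ ℵ₀ ↔ Nonempty (G.Coloring ℕ) := by
  constructor
  · intro h
    obtain ⟨C, hC, ⟨c⟩⟩ : chromaticCardinal G ∈
        {μ : Cardinal.{u} | ∃ C : Type u, #C = μ ∧ Nonempty (G.Coloring C)} :=
      csInf_mem ⟨#V, V, rfl, ⟨G.selfColoring⟩⟩
    rw [← hC, Cardinal.mk_le_aleph0_iff] at h
    obtain ⟨e, he⟩ := exists_injective_nat C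
    exact ⟨SimpleGraph.Coloring.mk (fun v => e (c v)) fun h' => he.ne (c.valid h')⟩
  · rintro ⟨c⟩
    refine csInf_le' ⟨ULift.{u} ℕ, by simp, ⟨SimpleGraph.Coloring.mk (fun v => ⟨c v⟩) ?_⟩⟩
    intro v w h h'
    exact c.valid h (congrArg ULift.down h')

theorem isSpecial_of_coloring {T : Type u} [PartialOrder T]
    (c : (comparabilityGraph T).Coloring ℕ) : IsSpecial T := by
  refine ⟨c, fun s hs x hx y hy hxy => ?_⟩
  by_contra hne
  exact c.valid (show (comparabilityGraph T).Adj x y from ⟨hne, hs hx hy hne⟩) hxy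

theorem IsSetTree.not_isMinor {T : Type u} [PartialOrder T] (hT : IsSetTree T)
    (hb : ¬ ∃ b : Set T, IsBranch b ∧ ¬ b.Countable) :
    ¬ IsMinor completeOmegaOne.{u} (comparabilityGraph T) := by
  rintro ⟨X, hdisj, hconn, hadj⟩
  choose r hr using fun a => hT.exists_isLeast_of_connected (hconn a)
  have hinj : Function.Injective r := by
    intro a b hab
    by_contra hne
    exact Set.disjoint_left.1 (hdisj a b hne) (hr a).1 (hab ▸ (hr b).1)
  refine hb (exists_uncountable_branch_iff.2 ⟨Set.range r, ?_, fun h => ?_⟩)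
  · rintro _ ⟨a, rfl⟩ _ ⟨b, rfl⟩ hne
    obtain ⟨x, hx, y, hy, -, hxy⟩ := hadj a b (by rintro rfl; exact hne rfl)
    -- Both roots lie below the larger end of the edge, hence are comparable.
    rcases hxy with hxy | hxy
    · exact hT.le_or_le (((hr a).2 hx).trans hxy) ((hr b).2 hy)
    · exact hT.le_or_le ((hr a).2 hx) (((hr b).2 hy).trans hxy)
  · exact not_countable_omegaOne
      ((Set.countable_univ_iff).1 (Set.countable_of_injective_of_countable_image
        (f := r) (s := Set.univ) hinj.injOn (by rwa [Set.image_univ])))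

theorem specialTreeSizes_subset_hadwigerSizes :
    specialTreeSizes.{u} ⊆ hadwigerSizes.{u} := by
  rintro μ ⟨T, _, hμ, hT, hsp, hb⟩
  refine ⟨T, comparabilityGraph T, hμ, ?_, hT.not_isMinor hb⟩
  rw [← not_le, chromaticCardinal_le_aleph0_iff]
  rintro ⟨c⟩
  exact hsp (isSpecial_of_coloring c)

/-! ### A non-special tree without uncountable branches. -/

/-- Every nonempty subset of `s` has a least element. -/
def WellOrderedSubset (s : Set ℝ) : Prop :=
  ∀ S ⊆ s, S.Nonempty → ∃ m, IsLeast S m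

/-- The well-ordered sets of reals, to be ordered by end-extension. -/
@[ext]
structure WellOrderedReals : Type u where
  carrier : Set ℝ
  wellOrdered : WellOrderedSubset carrier

namespace WellOrderedReals

instance : PartialOrder WellOrderedReals.{u} where
  le s t := s.carrier ⊆ t.carrier ∧ ∀ x ∈ s.carrier, ∀ y ∈ t.carrier, y ≤ x → y ∈ s.carrier
  le_refl s := ⟨subset_rfl, fun _ _ _ hy _ => hy⟩
  le_trans s t r hst htr := ⟨hst.1.trans htr.1, fun x hx y hy hyx =>
    hst.2 x hx y (htr.2 x (hst.1 hx) y hy hyx) hyx⟩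
  le_antisymm s t hst hts := WellOrderedReals.ext (hst.1.antisymm hts.1)

theorem le_def {s t : WellOrderedReals.{u}} : s ≤ t ↔
    s.carrier ⊆ t.carrier ∧ ∀ x ∈ s.carrier, ∀ y ∈ t.carrier, y ≤ x → y ∈ s.carrier := Iff.rfl

theorem le_or_le {s s' t : WellOrderedReals.{u}} (hs : s ≤ t) (hs' : s' ≤ t) :
    s ≤ s' ∨ s' ≤ s := by
  by_cases h : s.carrier ⊆ s'.carrier
  · exact Or.inl ⟨h, fun x hx y hy hyx => hs.2 x hx y (hs'.1 hy) hyx⟩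
  · obtain ⟨x, hx, hx'⟩ := Set.not_subset.1 h
    refine Or.inr ⟨fun y hy => ?_, fun a ha y hy hya => hs'.2 a ha y (hs.1 hy) hya⟩
    rcases le_total x y with hxy | hyx
    · exact absurd (hs'.2 y hy x (hs.1 hx) hxy) hx'
    · exact hs.2 x hx y (hs'.1 hy) hyx

theorem exists_mem_notMem_of_lt {s t : WellOrderedReals.{u}} (h : s < t) :
    ∃ x ∈ t.carrier, x ∉ s.carrier := by
  by_contra! hc
  exact h.ne (WellOrderedReals.ext (h.le.1.antisymm hc))

theorem isSetTree : IsSetTree WellOrderedReals.{u} := by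
  refine isSetTree_of_comparable (fun _ _ _ => le_or_le) fun t S hS hSt => ?_
  obtain ⟨s₀, hs₀⟩ := hS
  obtain ⟨x, hx, hx'⟩ := exists_mem_notMem_of_lt (hSt hs₀)
  -- Take the least point of `t` missed by some member of `S`; a member missing it is minimal.
  obtain ⟨d, ⟨hdt, m, hm, hdm⟩, hd⟩ := t.wellOrdered
    {x | x ∈ t.carrier ∧ ∃ s ∈ S, x ∉ s.carrier} (fun _ h => h.1) ⟨x, hx, s₀, hs₀, hx'⟩
  refine ⟨m, hm, fun s hs hlt => ?_⟩
  obtain ⟨y, hy, hy'⟩ := exists_mem_notMem_of_lt hlt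
  have hmt : m < t := hSt hm
  have hyt := hmt.le.1 hy
  exact hdm (hmt.le.2 y hy d hdt (hd ⟨hyt, s, hs, hy'⟩))

end WellOrderedReals

/-- Every non-maximal point has a successor in the set, hence a gap to its right, and there are only
countably many gaps. -/
theorem WellOrderedSubset.countable {U : Set ℝ} (hU : WellOrderedSubset U) : U.Countable := by
  have h := countable_image_lt_image_Ioi_within U (id : ℝ → ℝ)
  refine (h.union (Set.Subsingleton.countable (s := {x | IsGreatest U x})
    fun x hx y hy => IsGreatest.unique hx hy)).mono fun x hx => ?_
  by_cases hg : IsGreatest U x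
  · exact Or.inr hg
  · obtain ⟨y, hy, hxy⟩ : ∃ y ∈ U, x < y := by
      by_contra! hc
      exact hg ⟨hx, hc⟩
    obtain ⟨z, hz, hmin⟩ := hU {y ∈ U | x < y} (fun _ h => h.1) ⟨y, hy, hxy⟩
    exact Or.inl ⟨hx, z, hz.2, fun y hy hxy => hmin ⟨hy, hxy⟩⟩

namespace WellOrderedReals

theorem wellOrderedSubset_iUnion_of_isChain {b : Set WellOrderedReals.{u}}
    (hb : IsChain (fun s t => s ≤ t) b) : WellOrderedSubset (⋃ s ∈ b, s.carrier) := by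
  rintro S hS ⟨x, hx⟩
  obtain ⟨s, hs, hxs⟩ := Set.mem_iUnion₂.1 (hS hx)
  obtain ⟨m, hm, hmin⟩ := s.wellOrdered (S ∩ s.carrier) Set.inter_subset_right ⟨x, hx, hxs⟩
  refine ⟨m, hm.1, fun y hy => ?_⟩
  by_contra! hlt
  obtain ⟨s', hs', hys'⟩ := Set.mem_iUnion₂.1 (hS hy)
  have hys : y ∈ s.carrier := by
    rcases hb.total hs hs' with h | h
    · exact h.2 m hm.2 y hys' hlt.le
    · exact h.1 hys'
  exact absurd (hmin ⟨hy, hys⟩) (not_le.2 hlt)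

/-- Sending a member to the least point of the union that it misses is injective into a countable
set; at most one member misses nothing. -/
theorem countable_of_isChain {b : Set WellOrderedReals.{u}}
    (hb : IsChain (fun s t => s ≤ t) b) : b.Countable := by
  set U : Set ℝ := ⋃ s ∈ b, s.carrier with hUdef
  have hU : WellOrderedSubset U := wellOrderedSubset_iUnion_of_isChain hb
  have hsub : ∀ s ∈ b, s.carrier ⊆ U := fun s hs => Set.subset_biUnion_of_mem hs
  have hm : ∀ s ∈ {s ∈ b | ¬ U ⊆ s.carrier}, ∃ m, IsLeast (U \ s.carrier) m := by
    rintro s ⟨-, hs⟩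
    exact hU _ Set.sdiff_subset (Set.sdiff_nonempty.2 hs)
  choose! m hm using hm
  have hlt : ∀ s ∈ {s ∈ b | ¬ U ⊆ s.carrier}, ∀ s' ∈ {s ∈ b | ¬ U ⊆ s.carrier},
      s ≤ s' → m s = m s' → s = s' := by
    intro s hs s' hs' hle heq
    refine WellOrderedReals.ext (hle.1.antisymm fun x hx => ?_)
    by_contra hxs
    have h1 : m s ≤ x := (hm s hs).2 ⟨hsub s' hs'.1 hx, hxs⟩
    obtain ⟨r, hr, hmr⟩ := Set.mem_iUnion₂.1 (hm s hs).1.1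
    refine (hm s' hs').1.2 (heq ▸ ?_)
    rcases hb.total hs'.1 hr with h | h
    · exact h.2 x hx _ hmr h1
    · exact h.1 hmr
  have h1 : {s ∈ b | ¬ U ⊆ s.carrier}.Countable := by
    refine Set.MapsTo.countable_of_injOn (f := m) (t := U) (fun s hs => (hm s hs).1.1) ?_
      hU.countable
    intro s hs s' hs' heq
    rcases hb.total hs.1 hs'.1 with h | h
    · exact hlt s hs s' hs' h heq
    · exact (hlt s' hs' s hs h heq.symm).symm
  have h2 : {s ∈ b | U ⊆ s.carrier}.Countable := by
    refine Set.Subsingleton.countable fun s hs s' hs' => WellOrderedReals.ext ?_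
    exact ((hsub s hs.1).trans hs'.2).antisymm ((hsub s' hs'.1).trans hs.2)
  refine (h1.union h2).mono fun s hs => ?_
  by_cases h : U ⊆ s.carrier
  · exact Or.inr ⟨hs, h⟩
  · exact Or.inl ⟨hs, h⟩

end WellOrderedReals

/-- Sum `2^{-n}` over the values `n` of `f` on the elements below `t`: injectivity on chains makes
`f t` a new value. -/
theorem IsSpecial.exists_strictMono {T : Type u} [PartialOrder T] (hT : IsSetTree T)
    (h : IsSpecial T) : ∃ g : T → ℝ, StrictMono g := by
  obtain ⟨f, hf⟩ := h
  have hsum : ∀ A : Set ℕ, Summable (A.indicator fun n => ((1 : ℝ) / 2) ^ n) :=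
    fun A => summable_geometric_two.indicator A
  refine ⟨fun t => ∑' n, (f '' Set.Iic t).indicator (fun n => ((1 : ℝ) / 2) ^ n) n, ?_⟩
  intro s t hst
  refine Summable.tsum_lt_tsum (i := f t) ?_ ?_ (hsum _) (hsum _)
  · exact Set.indicator_le_indicator_of_subset (Set.image_mono (Set.Iic_subset_Iic.2 hst.le))
      fun n => by positivity
  · have h1 : f t ∉ f '' Set.Iic s := by
      rintro ⟨r, hr, hrt⟩
      have := hf _ (hT.isChain_Iic t) (show r ∈ Set.Iic t from le_trans hr hst.le)
        (show t ∈ Set.Iic t from le_rfl) hrt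
      subst this
      exact absurd hst (not_lt_of_ge hr)
    have h2 : f t ∈ f '' Set.Iic t := ⟨t, le_rfl, rfl⟩
    rw [Set.indicator_of_notMem h1, Set.indicator_of_mem h2]
    positivity

/-- The recursion `h a = F {h b | b < a}` along a well-order. -/
noncomputable def iterateOnImage {I : Type u} {X : Type v} [LinearOrder I] [WellFoundedLT I]
    (F : Set X → X) : I → X :=
  (wellFounded_lt (α := I)).fix fun a ih => F (Set.range fun b : Set.Iio a => ih b.1 b.2)

theorem iterateOnImage_eq {I : Type u} {X : Type v} [LinearOrder I] [WellFoundedLT I]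
    (F : Set X → X) (a : I) :
    iterateOnImage F a = F (Set.range fun b : Set.Iio a => iterateOnImage F b.1) :=
  WellFounded.fix_eq _ _ _

namespace WellOrderedReals

/-- Otherwise `h α = g {h β | β < α}` would embed all ordinals into the reals. -/
theorem not_strictMono (g : WellOrderedReals.{u} → ℝ) : ¬ StrictMono g := by
  classical
  intro hg
  -- The default value 0 is never used: `hwo` shows that the sets that occur are well-ordered.
  set G : Set ℝ → ℝ := fun s => if hs : WellOrderedSubset s then g ⟨s, hs⟩ else 0 with hG
  set h : Ordinal.{0} → ℝ := iterateOnImage G with hh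
  have heq : ∀ α, h α = G (Set.range fun β : Set.Iio α => h β.1) := iterateOnImage_eq G
  have hmono : ∀ α, ∀ β < α, h β < h α := by
    intro α
    induction α using WellFoundedLT.induction with
    | _ α ih =>
    have hwo : ∀ γ ≤ α, WellOrderedSubset (Set.range fun β : Set.Iio γ => h β.1) := by
      rintro γ hγ S hS ⟨x, hx⟩
      obtain ⟨β₀, rfl⟩ := hS hx
      obtain ⟨β, ⟨hβγ, hβ⟩, hmin⟩ := WellFounded.has_min (wellFounded_lt (α := Ordinal.{0}))
        {β | β < γ ∧ h β ∈ S} ⟨β₀.1, β₀.2, hx⟩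
      refine ⟨h β, hβ, fun y hy => ?_⟩
      obtain ⟨⟨β', hβ'⟩, rfl⟩ := hS hy
      rcases (not_lt.1 (hmin β' ⟨hβ', hy⟩)).eq_or_lt with rfl | hlt
      · exact le_rfl
      · exact (ih β' (lt_of_lt_of_le hβ' hγ) β hlt).le
    intro β hβ
    rw [heq β, heq α, hG]
    simp only [dif_pos (hwo β hβ.le), dif_pos (hwo α le_rfl)]
    refine hg (lt_of_le_of_ne (le_def.2 ⟨?_, ?_⟩) fun hE => ?_)
    · rintro _ ⟨⟨γ, hγ⟩, rfl⟩
      exact ⟨⟨γ, lt_trans hγ hβ⟩, rfl⟩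
    · rintro _ ⟨⟨γ, hγ⟩, rfl⟩ _ ⟨⟨δ, hδ⟩, rfl⟩ hle
      have hδγ : δ ≤ γ := not_lt.1 fun hlt => absurd hle (not_le.2 (ih δ hδ γ hlt))
      exact ⟨⟨δ, hδγ.trans_lt hγ⟩, rfl⟩
    · have : h β ∈ Set.range fun γ : Set.Iio β => h γ.1 := by
        have hE' : (Set.range fun γ : Set.Iio β => h γ.1) = Set.range fun γ : Set.Iio α => h γ.1 :=
          congrArg carrier hE
        rw [hE']
        exact ⟨⟨β, hβ⟩, rfl⟩
      obtain ⟨⟨γ, hγ⟩, hγβ⟩ := this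
      exact (ih β hβ γ hγ).ne hγβ
  exact not_injective_of_ordinal h (StrictMono.injective fun _ _ hlt => hmono _ _ hlt)

theorem mk_mem_specialTreeSizes : #WellOrderedReals.{u} ∈ specialTreeSizes.{u} := by
  refine ⟨WellOrderedReals.{u}, inferInstance, rfl, isSetTree, fun hsp => ?_, ?_⟩
  · obtain ⟨g, hg⟩ := hsp.exists_strictMono isSetTree
    exact not_strictMono g hg
  · rw [exists_uncountable_branch_iff]
    rintro ⟨c, hc, hu⟩
    exact hu (countable_of_isChain hc)

end WellOrderedReals

/-! ### Components and the construction of one layer. -/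

section Joined

variable {V : Type u} {G : SimpleGraph V} {R R' : Set V} {v w x : V}

variable (G) in
/-- `v` and `w` lie in the same component of the subgraph induced on `R`. -/
def Joined (R : Set V) (v w : V) : Prop :=
  ∃ X : Set V, X.Countable ∧ X ⊆ R ∧ v ∈ X ∧ w ∈ X ∧ (G.induce X).Connected

theorem connected_induce_singleton (v : V) : (G.induce {v}).Connected :=
  haveI : Nonempty ({v} : Set V) := ⟨⟨v, rfl⟩⟩
  { preconnected := by
      rintro ⟨a, rfl⟩ ⟨b, rfl⟩
      exact SimpleGraph.Reachable.refl _ }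

theorem Joined.refl (hv : v ∈ R) : Joined G R v v :=
  ⟨{v}, Set.countable_singleton v, by simpa using hv, rfl, rfl, connected_induce_singleton v⟩

theorem Joined.symm : Joined G R v w → Joined G R w v :=
  fun ⟨X, h1, h2, h3, h4, h5⟩ => ⟨X, h1, h2, h4, h3, h5⟩

theorem Joined.trans : Joined G R v w → Joined G R w x → Joined G R v x :=
  fun ⟨X, h1, h2, h3, h4, h5⟩ ⟨Y, k1, k2, k3, k4, k5⟩ =>
    ⟨X ∪ Y, h1.union k1, Set.union_subset h2 k2, Or.inl h3, Or.inr k4,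
      SimpleGraph.induce_union_connected h5.preconnected k5.preconnected ⟨w, h4, k3⟩⟩

theorem Joined.mono (hR : R ⊆ R') : Joined G R v w → Joined G R' v w :=
  fun ⟨X, h1, h2, h3⟩ => ⟨X, h1, h2.trans hR, h3⟩

theorem Joined.mem_right : Joined G R v w → w ∈ R := fun ⟨_, _, h2, _, h4, _⟩ => h2 h4

theorem Joined.of_adj (hv : v ∈ R) (hw : w ∈ R) (h : G.Adj v w) : Joined G R v w :=
  ⟨{v, w}, (Set.countable_singleton w).insert v, Set.pair_subset hv hw, by simp, by simp,
    SimpleGraph.induce_pair_connected_of_adj h⟩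

theorem Joined.exists_boundary (h : Joined G R v w) {S : Set V} (hv : v ∈ S) (hw : w ∉ S) :
    ∃ x ∈ S, ∃ y ∉ S, x ∈ R ∧ y ∈ R ∧ G.Adj x y := by
  obtain ⟨X, -, hXR, hvX, hwX, hX⟩ := h
  obtain ⟨p⟩ := hX.preconnected ⟨v, hvX⟩ ⟨w, hwX⟩
  obtain ⟨d, -, hd, hd'⟩ := p.exists_boundary_dart (Subtype.val ⁻¹' S) hv hw
  exact ⟨_, hd, _, hd', hXR d.fst.2, hXR d.snd.2, d.adj⟩

theorem exists_countable_connected (hv : v ∈ R) {S : Set V} (hS : S.Countable)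
    (hSR : ∀ s ∈ S, Joined G R v s) :
    ∃ K : Set V, K.Countable ∧ v ∈ K ∧ S ⊆ K ∧ (∀ w ∈ K, Joined G R v w) ∧
      (G.induce K).Connected := by
  choose! X hX using hSR
  have hin : ∀ A ∈ insert {v} (X '' S), v ∈ A := by
    rintro A (rfl | ⟨s, hs, rfl⟩)
    · rfl
    · exact (hX s hs).2.2.1
  refine ⟨⋃₀ (insert {v} (X '' S)), ?_, ?_, ?_, ?_, ?_⟩
  · refine Set.Countable.sUnion ((hS.image X).insert _) ?_
    rintro A (rfl | ⟨s, hs, rfl⟩)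
    · exact Set.countable_singleton v
    · exact (hX s hs).1
  · exact Set.mem_sUnion.2 ⟨{v}, Set.mem_insert _ _, rfl⟩
  · exact fun s hs => Set.mem_sUnion.2 ⟨X s, Or.inr ⟨s, hs, rfl⟩, (hX s hs).2.2.2.1⟩
  · rintro w ⟨A, rfl | ⟨s, hs, rfl⟩, hw⟩
    · rw [Set.mem_singleton_iff.1 hw]
      exact Joined.refl hv
    · exact ⟨X s, (hX s hs).1, (hX s hs).2.1, (hX s hs).2.2.1, hw, (hX s hs).2.2.2.2⟩
  · refine SimpleGraph.induce_sUnion_connected_of_pairwise_not_disjoint ⟨_, Set.mem_insert _ _⟩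
      (fun {s t} hs ht => ⟨v, hin s hs, hin t ht⟩) ?_
    rintro A (rfl | ⟨s, hs, rfl⟩)
    · exact connected_induce_singleton v
    · exact (hX s hs).2.2.2.2

variable (G) in
/-- `A` meets each component of the complement of `⋃₀ 𝒩` in a countable connected set which has
neighbours in all those members of `𝒩` in which the component has neighbours. -/
structure IsLayer (𝒩 : Set (Set V)) (A : Set V) : Prop where
  subset : A ⊆ (⋃₀ 𝒩)ᶜ
  countable : ∀ v ∈ (⋃₀ 𝒩)ᶜ, {w ∈ A | Joined G (⋃₀ 𝒩)ᶜ v w}.Countable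
  connected : ∀ v ∈ (⋃₀ 𝒩)ᶜ, (G.induce {w ∈ A | Joined G (⋃₀ 𝒩)ᶜ v w}).Connected
  adj : ∀ v ∈ (⋃₀ 𝒩)ᶜ, ∀ N ∈ 𝒩, (∃ x, Joined G (⋃₀ 𝒩)ᶜ v x ∧ ∃ y ∈ N, G.Adj x y) →
    ∃ x ∈ A, Joined G (⋃₀ 𝒩)ᶜ v x ∧ ∃ y ∈ N, G.Adj x y

theorem exists_isLayer {𝒩 : Set (Set V)} (h𝒩 : 𝒩.Countable) : ∃ A, IsLayer G 𝒩 A := by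
  set R : Set V := (⋃₀ 𝒩)ᶜ with hR
  have key : ∀ C : Set V, (∃ v ∈ R, C = {w | Joined G R v w}) →
      ∃ K ⊆ C, K.Countable ∧ (G.induce K).Connected ∧
        ∀ N ∈ 𝒩, (∃ x ∈ C, ∃ y ∈ N, G.Adj x y) → ∃ x ∈ K, ∃ y ∈ N, G.Adj x y := by
    rintro C ⟨v, hv, rfl⟩
    have : Nonempty V := ⟨v⟩
    set 𝒩' := {N ∈ 𝒩 | ∃ x ∈ {w | Joined G R v w}, ∃ y ∈ N, G.Adj x y} with h𝒩'
    have hx : ∀ N ∈ 𝒩', ∃ x ∈ {w | Joined G R v w}, ∃ y ∈ N, G.Adj x y := fun N hN => hN.2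
    choose! f hf using hx
    obtain ⟨K, hK, -, hSK, hKR, hKc⟩ := exists_countable_connected (G := G) hv
      (S := f '' 𝒩') ((h𝒩.mono fun N hN => hN.1).image f)
      (by rintro _ ⟨N, hN, rfl⟩; exact (hf N hN).1)
    exact ⟨K, hKR, hK, hKc, fun N hN hx => ⟨f N, hSK ⟨N, ⟨hN, hx⟩, rfl⟩, (hf N ⟨hN, hx⟩).2⟩⟩
  -- The choice depends on the component as a set, so all its vertices share one `K`.
  choose! K hK using key
  have hcomp : ∀ v w, Joined G R v w → {x | Joined G R w x} = {x | Joined G R v x} :=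
    fun v w h => Set.ext fun x => ⟨h.trans, h.symm.trans⟩
  have hA : ∀ v ∈ R, {w ∈ {w ∈ R | w ∈ K {x | Joined G R w x}} | Joined G R v w} =
      K {x | Joined G R v x} := by
    intro v hv
    ext w
    constructor
    · rintro ⟨⟨-, hw⟩, hvw⟩
      rwa [← hcomp v w hvw]
    · intro hw
      have hvw : Joined G R v w := (hK _ ⟨v, hv, rfl⟩).1 hw
      refine ⟨⟨hvw.mem_right, ?_⟩, hvw⟩
      show w ∈ K _
      rwa [hcomp v w hvw]
  refine ⟨{w ∈ R | w ∈ K {x | Joined G R w x}}, fun w hw => hw.1, fun v hv => ?_, fun v hv => ?_,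
    fun v hv N hN hx => ?_⟩
  · rw [hA v hv]
    exact (hK _ ⟨v, hv, rfl⟩).2.1
  · rw [hA v hv]
    exact (hK _ ⟨v, hv, rfl⟩).2.2.1
  · obtain ⟨x, hx, hy⟩ := (hK _ ⟨v, hv, rfl⟩).2.2.2 N hN hx
    rw [← hA v hv] at hx
    exact ⟨x, hx.1, hx.2, hy⟩

end Joined

/-! ### Transfinite layerings. -/

section Layering

variable {I : Type v} [LinearOrder I] {V : Type u} {G : SimpleGraph V} {U : I → Set V}

/-- The vertices not in the layers before `a`. -/
def remainder (U : I → Set V) (a : I) : Set V := {v | ∀ b < a, v ∉ U b}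

theorem remainder_anti {a b : I} (h : a ≤ b) : remainder U b ⊆ remainder U a :=
  fun _ hv c hc => hv c (hc.trans_le h)

variable (G U) in
/-- The part of the layer `U a` in the component of `v` of what remains before `a`. -/
def bag (a : I) (v : V) : Set V := {w ∈ U a | Joined G (remainder U a) v w}

variable (G U) in
/-- Each `U a` is a layer over the earlier ones. -/
structure IsLayering : Prop where
  subset : ∀ a, U a ⊆ remainder U a
  countable : ∀ a, ∀ v ∈ remainder U a, (bag G U a v).Countable
  connected : ∀ a, ∀ v ∈ remainder U a, (G.induce (bag G U a v)).Connected
  adj : ∀ a, ∀ v ∈ remainder U a, ∀ b < a,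
    (∃ x, Joined G (remainder U a) v x ∧ ∃ y ∈ U b, G.Adj x y) →
      ∃ x ∈ bag G U a v, ∃ y ∈ U b, G.Adj x y

variable (G) in
theorem exists_isLayering [WellFoundedLT I] (hI : ∀ a : I, (Set.Iio a).Countable) :
    ∃ U : I → Set V, IsLayering G U := by
  have h : ∀ 𝒩 : Set (Set V), 𝒩.Countable → ∃ A, IsLayer G 𝒩 A := fun _ => exists_isLayer
  choose! F hF using h
  set U : I → Set V := iterateOnImage F with hU
  have hrem : ∀ a, (⋃₀ (Set.range fun b : Set.Iio a => U b.1))ᶜ = remainder U a := by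
    intro a
    ext v
    simp [remainder]
  have hlayer : ∀ a, IsLayer G (Set.range fun b : Set.Iio a => U b.1) (U a) := by
    intro a
    have : U a = F (Set.range fun b : Set.Iio a => U b.1)  :=
      iterateOnImage_eq F a
    rw [this]
    have := (hI a).to_subtype
    exact hF _ (Set.countable_range _)
  refine ⟨U, fun a => ?_, fun a => ?_, fun a => ?_, fun a v hv b hb hx => ?_⟩
  · rw [← hrem]
    exact (hlayer a).subset
  · have := (hlayer a).countable
    rwa [hrem] at this
  · have := (hlayer a).connected
    rwa [hrem] at this
  · have := (hlayer a).adj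
    rw [hrem] at this
    obtain ⟨x, hx, hx', hy⟩ := this v hv (U b) ⟨⟨b, hb⟩, rfl⟩ hx
    exact ⟨x, ⟨hx, hx'⟩, hy⟩

theorem IsLayering.eq_of_mem (hU : IsLayering G U) {a b : I} {v : V} (ha : v ∈ U a)
    (hb : v ∈ U b) : a = b := by
  rcases lt_trichotomy a b with h | h | h
  · exact absurd ha (hU.subset b hb a h)
  · exact h
  · exact absurd hb (hU.subset a ha b h)

end Layering

/-! ### Bounds and closure points in orders of type `ω₁`. -/

section Bounds

variable {I : Type v} [LinearOrder I]

theorem exists_forall_lt_of_countable (hI : ∀ a : I, (Set.Iio a).Countable)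
    (hunc : ¬ Countable I) {S : Set I} (hS : S.Countable) : ∃ d, ∀ s ∈ S, s < d := by
  by_contra! hc
  refine hunc (Set.countable_univ_iff.1 ((hS.biUnion (t := fun s _ => Set.Iic s) fun s _ => ?_).mono
    fun d _ => ?_))
  · rw [← Set.Iio_insert]
    exact (hI s).insert s
  · obtain ⟨s, hs, hd⟩ := hc d
    exact Set.mem_iUnion₂.2 ⟨s, hs, hd⟩

/-- The point is the supremum of the iterates of a step that dominates `f` on initial segments. -/
theorem exists_closed_point [WellFoundedLT I] (hI : ∀ a : I, (Set.Iio a).Countable)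
    (hunc : ¬ Countable I) (f : I → I) (a : I) :
    ∃ d, a < d ∧ ∀ b < d, ∃ c < d, b < c ∧ ∀ e ≤ b, f e ≤ c := by
  have hstep : ∀ b : I, ∃ c, b < c ∧ ∀ e ≤ b, f e ≤ c := by
    intro b
    have hb : (insert b (Set.Iio b)).Countable := (hI b).insert b
    obtain ⟨c, hc⟩ := exists_forall_lt_of_countable hI hunc
      ((hb.image f).insert b)
    refine ⟨c, hc b (Set.mem_insert _ _), fun e he => (hc _ (Or.inr ⟨e, ?_, rfl⟩)).le⟩
    rcases he.eq_or_lt with rfl | h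
    · exact Set.mem_insert _ _
    · exact Or.inr h
  choose s hs using hstep
  obtain ⟨d₀, hd₀⟩ := exists_forall_lt_of_countable hI hunc
    (Set.countable_range fun n : ℕ => s^[n] a)
  obtain ⟨d, hd, hmin⟩ := WellFounded.has_min (wellFounded_lt (α := I))
    {d | ∀ n : ℕ, s^[n] a < d} ⟨d₀, fun n => hd₀ _ ⟨n, rfl⟩⟩
  refine ⟨d, hd 0, fun b hb => ?_⟩
  obtain ⟨n, hn⟩ : ∃ n : ℕ, b ≤ s^[n] a := by
    by_contra! hc
    exact hmin b hc hb
  refine ⟨s^[n + 1] a, hd _, ?_⟩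
  rw [Function.iterate_succ_apply']
  exact ⟨hn.trans_lt (hs _).1, fun e he => (hs _).2 e (he.trans hn)⟩

end Bounds

/-! ### Threads yield minors. -/

section Threads

variable {I : Type u} [LinearOrder I] [WellFoundedLT I] {V : Type v} {G : SimpleGraph V}
  {U : I → Set V}

/-- Call a level persistent if the thread's component at every later level has a neighbour in its
layer. The bags at persistent levels are pairwise adjacent, and these levels are unbounded. -/
theorem IsLayering.isMinor_of_thread (hU : IsLayering G U)
    (hI : ∀ a : I, (Set.Iio a).Countable) (hunc : ¬ Countable I) (v : I → V)
    (hv : ∀ a, v a ∈ remainder U a)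
    (hjoin : ∀ b a, b ≤ a → Joined G (remainder U b) (v b) (v a)) :
    IsMinor completeOmegaOne.{u} G := by
  set nbr : I → I → Prop := fun a b =>
    ∃ x, Joined G (remainder U a) (v a) x ∧ ∃ y ∈ U b, G.Adj x y with hnbr
  have hanti : ∀ a a' b, a ≤ a' → nbr a' b → nbr a b := by
    rintro a a' b h ⟨x, hx, hy⟩
    exact ⟨x, (hjoin a a' h).trans (hx.mono (remainder_anti h)), hy⟩
  set B : Set I := {b | ∀ a, b < a → nbr a b} with hB
  have hadj : ∀ a b, b ∈ B → b < a →
      ∃ x ∈ bag G U a (v a), ∃ y ∈ bag G U b (v b), G.Adj x y := by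
    intro a b hb hlt
    obtain ⟨x, hx, y, hy, hxy⟩ := hU.adj a (v a) (hv a) b hlt (hb a hlt)
    refine ⟨x, hx, y, ⟨hy, ?_⟩, hxy⟩
    have h1 := (hjoin b a hlt.le).trans (hx.2.mono (remainder_anti hlt.le))
    exact h1.trans (Joined.of_adj h1.mem_right (hU.subset b hy) hxy)
  have hBunb : ∀ a, ∃ b ∈ B, a ≤ b := by
    intro a
    by_contra! hc
    have hf : ∀ b, ∃ c, a ≤ b → b < c ∧ ¬ nbr c b := by
      intro b
      by_cases hab : a ≤ b
      · by_contra! hcon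
        exact absurd hab (not_le.2 (hc b fun c hbc => (hcon c).2 hbc))
      · exact ⟨b, fun h => absurd h hab⟩
    choose f hf using hf
    -- At a closure point `d`, every layer from `a` up to `d` has already lost adjacency to the
    -- thread. Yet a path from `v d` to layer `a` leaves the component at `d` through such a layer.
    obtain ⟨d, had, hd⟩ := exists_closed_point hI hunc f a
    obtain ⟨⟨u, hu⟩⟩ := (hU.connected a (v a) (hv a)).nonempty
    obtain ⟨x, hx, y, hy, -, hyR, hxy⟩ := ((hjoin a d had.le).symm.trans hu.2).exists_boundary
      (S := {x | Joined G (remainder U d) (v d) x}) (Joined.refl (hv d))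
      (fun h => h.mem_right a had hu.1)
    obtain ⟨b, hbd, hyb⟩ : ∃ b < d, y ∈ U b := by
      by_contra! hyd
      exact hy (Joined.trans hx (Joined.of_adj (Joined.mem_right hx) hyd hxy))
    have hab : a ≤ b := not_lt.1 fun h => hyR b h hyb
    obtain ⟨c, hcd, hbc, hc⟩ := hd b hbd
    exact (hf b hab).2 (hanti _ _ _ ((hc b le_rfl).trans hcd.le) ⟨x, hx, y, hyb, hxy⟩)
  have hBunc : ¬ Countable B := by
    intro h
    obtain ⟨d, hd⟩ := exists_forall_lt_of_countable hI hunc (Set.countable_coe_iff.1 h)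
    obtain ⟨b, hb, hdb⟩ := hBunb d
    exact absurd (hd b hb) (not_lt.2 hdb)
  obtain ⟨e⟩ := exists_omegaOne_embedding hBunc
  refine ⟨fun i => bag G U (e i).1 (v (e i).1), fun i j hij => ?_,
    fun i => hU.connected _ _ (hv _), fun i j hij => ?_⟩
  · refine Set.disjoint_left.2 fun x hx hx' => hij (e.injective (Subtype.ext ?_))
    exact hU.eq_of_mem hx.1 hx'.1
  · rcases lt_trichotomy (e i).1 (e j).1 with h | h | h
    · obtain ⟨x, hx, y, hy, hxy⟩ := hadj _ _ (e i).2 h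
      exact ⟨y, hy, x, hx, hxy.symm⟩
    · exact absurd (e.injective (Subtype.ext h)) hij.ne
    · exact hadj _ _ (e j).2 h

end Threads

/-! ### The tree order of a layering, and the inclusion from graphs to trees. -/

section TreeOrder

variable {I : Type u} [LinearOrder I] {V : Type u} {G : SimpleGraph V}
  {U : I → Set V} {l : V → I} {e : V → ℕ}

variable (G U l e) in
/-- `v` lies weakly below `w` if `w` is in the component in which `v` was chosen, and `v` does not
come after `w` in the order of levels, refined by `e` within each level. -/
def LayerLE (v w : V) : Prop :=
  Joined G (remainder U (l v)) v w ∧ toLex (l v, e v) ≤ toLex (l w, e w)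

theorem level_le_of_toLex_le {v w : V} (h : toLex (l v, e v) ≤ toLex (l w, e w)) : l v ≤ l w := by
  rcases Prod.Lex.toLex_le_toLex.1 h with h | h
  · exact h.le
  · exact h.1.le

theorem IsLayering.mem_remainder (hU : IsLayering G U) (hl : ∀ v, v ∈ U (l v)) (v : V) :
    v ∈ remainder U (l v) :=
  hU.subset _ (hl v)

theorem bag_eq_of_joined {a : I} {v w : V} (h : Joined G (remainder U a) v w) :
    bag G U a v = bag G U a w :=
  Set.ext fun _ => ⟨fun hx => ⟨hx.1, h.symm.trans hx.2⟩, fun hx => ⟨hx.1, h.trans hx.2⟩⟩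

theorem IsLayering.exists_injOn_bag (hU : IsLayering G U) (hl : ∀ v, v ∈ U (l v)) :
    ∃ e : V → ℕ, ∀ v w, Joined G (remainder U (l v)) v w → l v = l w → e v = e w → v = w := by
  have h : ∀ K : Set V, K.Countable → ∃ f : V → ℕ, Set.InjOn f K :=
    fun K hK => Set.countable_iff_exists_injOn.1 hK
  choose! f hf using h
  -- The injection is chosen per bag, so vertices of one bag are numbered by the same map.
  refine ⟨fun v => f (bag G U (l v) v) v, fun v w hj hlvl he => ?_⟩
  have hw : w ∈ bag G U (l v) v := ⟨hlvl ▸ hl w, hj⟩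
  have hbag : bag G U (l w) w = bag G U (l v) v := by rw [← hlvl, bag_eq_of_joined hj]
  have hv := hU.mem_remainder hl v
  refine hf _ (hU.countable _ v hv) ⟨hl v, Joined.refl hv⟩ hw ?_
  simpa only [hbag] using he

/-- The tree order on the vertices induced by a layering. -/
@[reducible]
def IsLayering.partialOrder (hU : IsLayering G U) (hl : ∀ v, v ∈ U (l v))
    (he : ∀ v w, Joined G (remainder U (l v)) v w → l v = l w → e v = e w → v = w) :
    PartialOrder V where
  le := LayerLE G U l e
  le_refl v := ⟨Joined.refl (hU.mem_remainder hl v), le_rfl⟩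
  le_trans v w x hvw hwx :=
    ⟨hvw.1.trans (hwx.1.mono (remainder_anti (level_le_of_toLex_le hvw.2))), hvw.2.trans hwx.2⟩
  le_antisymm v w hvw hwv := by
    have h := Prod.ext_iff.1 (toLex.injective (hvw.2.antisymm hwv.2))
    exact he v w hvw.1 h.1 h.2

theorem IsLayering.isSetTree [WellFoundedLT I] (hU : IsLayering G U) (hl : ∀ v, v ∈ U (l v))
    (he : ∀ v w, Joined G (remainder U (l v)) v w → l v = l w → e v = e w → v = w) :
    letI := hU.partialOrder hl he
    IsSetTree V := by
  let := hU.partialOrder hl he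
  refine isSetTree_of_comparable ?_ ?_
  · have key : ∀ s s' t : V, s ≤ t → s' ≤ t → toLex (l s, e s) ≤ toLex (l s', e s') → s ≤ s' :=
      fun s s' t hs hs' hle =>
        ⟨hs.1.trans (hs'.1.mono (remainder_anti (level_le_of_toLex_le hle))).symm, hle⟩
    intro s s' t hs hs'
    rcases le_total (toLex (l s, e s)) (toLex (l s', e s')) with h | h
    · exact Or.inl (key s s' t hs hs' h)
    · exact Or.inr (key s' s t hs' hs h)
  · intro t S hS _
    obtain ⟨m, hm, hmin⟩ := WellFounded.has_min
      (InvImage.wf (fun v => toLex (l v, e v)) (wellFounded_lt (α := I ×ₗ ℕ))) S hS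
    refine ⟨m, hm, fun s hs hlt => hmin s hs (lt_of_le_of_ne hlt.le.2 fun heq => ?_)⟩
    have h := Prod.ext_iff.1 (toLex.injective heq)
    exact hlt.ne (he s m hlt.le.1 h.1 h.2)

theorem IsLayering.comparable_of_adj (hU : IsLayering G U) (hl : ∀ v, v ∈ U (l v)) {v w : V}
    (h : G.Adj v w) : LayerLE G U l e v w ∨ LayerLE G U l e w v := by
  have key : ∀ v w, G.Adj v w → toLex (l v, e v) ≤ toLex (l w, e w) → LayerLE G U l e v w :=
    fun v w h hle => ⟨Joined.of_adj (hU.mem_remainder hl v)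
      (remainder_anti (level_le_of_toLex_le hle) (hU.mem_remainder hl w)) h, hle⟩
  rcases le_total (toLex (l v, e v)) (toLex (l w, e w)) with hle | hle
  · exact Or.inl (key v w h hle)
  · exact Or.inr (key w v h.symm hle)

/-- On a chain the pair of level and number is injective, and only countably many pairs have level
below `a`. -/
theorem exists_le_level_of_isChain
    (he : ∀ v w, Joined G (remainder U (l v)) v w → l v = l w → e v = e w → v = w)
    (hI : ∀ a : I, (Set.Iio a).Countable) {c : Set V} (hc : IsChain (LayerLE G U l e) c)
    (hunc : ¬ c.Countable) (a : I) : ∃ v ∈ c, a ≤ l v := by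
  by_contra! hlt
  refine hunc (Set.MapsTo.countable_of_injOn (f := fun v => (l v, e v))
    (t := Set.Iio a ×ˢ Set.univ) (fun v hv => ⟨hlt v hv, trivial⟩) ?_
    ((hI a).prod Set.countable_univ))
  intro v hv w hw h
  have h := Prod.ext_iff.1 h
  by_contra hne
  rcases hc hv hw hne with h' | h'
  · exact hne (he v w h'.1 h.1 h.2)
  · exact hne (he w v h'.1 h.1.symm h.2.symm).symm

theorem hadwigerSizes_subset_specialTreeSizes :
    hadwigerSizes.{u} ⊆ specialTreeSizes.{u} := by
  rintro μ ⟨V, G, hμ, hχ, hminor⟩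
  have hI := countable_Iio_omegaOne.{u}
  have hunc := not_countable_omegaOne.{u}
  obtain ⟨U, hU⟩ := exists_isLayering G hI
  have hl : ∀ v, ∃ a, v ∈ U a := by
    intro v
    by_contra! hv
    -- A vertex in no layer is a constant thread.
    exact hminor (hU.isMinor_of_thread hI hunc (fun _ => v) (fun a b _ => hv b)
      fun b a _ => Joined.refl fun c _ => hv c)
  choose l hl using hl
  obtain ⟨e, he⟩ := hU.exists_injOn_bag hl
  refine ⟨V, hU.partialOrder hl he, hμ, hU.isSetTree hl he, ?_, ?_⟩
  · rintro ⟨f, hf⟩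
    refine absurd hχ (not_lt.2 ((chromaticCardinal_le_aleph0_iff G).2
      ⟨SimpleGraph.Coloring.mk f fun {v w} h heq => h.ne ?_⟩))
    refine hf {v, w} ?_ (Set.mem_insert _ _) (Set.mem_insert_of_mem _ rfl) heq
    rcases hU.comparable_of_adj hl h with hle | hle
    · exact IsChain.pair hle
    · rw [Set.pair_comm]
      exact IsChain.pair hle
  · rw [@exists_uncountable_branch_iff _ (hU.partialOrder hl he)]
    rintro ⟨c, hc, hcu⟩
    -- Chain elements of level at least `a`, one for each `a`, form a thread.
    choose v hvc hv using exists_le_level_of_isChain he hI hc hcu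
    refine hminor (hU.isMinor_of_thread hI hunc v
      (fun a => remainder_anti (hv a) (hU.mem_remainder hl (v a))) fun b a hba => ?_)
    by_cases hne : v b = v a
    · rw [← hne]
      exact Joined.refl (remainder_anti (hv b) (hU.mem_remainder hl (v b)))
    · rcases hc (hvc b) (hvc a) hne with h | h
      · exact h.1.mono (remainder_anti (hv b))
      · exact (h.1.mono (remainder_anti (hba.trans (hv a)))).symm

end TreeOrder

end UncountableHadwiger

/-- Both least sizes exist, and they are equal. -/
theorem mainTheorem2 :
    UncountableHadwiger.hadwigerSizes.{u}.Nonempty ∧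
    UncountableHadwiger.specialTreeSizes.{u}.Nonempty ∧
    UncountableHadwiger.hadwigerNumber.{u} = UncountableHadwiger.specialTreeNumber.{u} := by
  have h : UncountableHadwiger.specialTreeSizes.{u}.Nonempty :=
    ⟨_, UncountableHadwiger.WellOrderedReals.mk_mem_specialTreeSizes⟩
  have heq : UncountableHadwiger.hadwigerSizes.{u} = UncountableHadwiger.specialTreeSizes.{u} :=
    UncountableHadwiger.hadwigerSizes_subset_specialTreeSizes.antisymm
      UncountableHadwiger.specialTreeSizes_subset_hadwigerSizes
  exact ⟨heq ▸ h, h, congrArg sInf heq⟩
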